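/- Let $\mathcal A$ be a Desargues affine plane, i.e. an affine plane (two distinct points lie on exactly one line; through a point off a line there passes exactly one line missing it; there are three non-collinear points) satisfying Desargues' axiom in both its parallel and its concurrent form. Call two lines parallel if they are equal or disjoint. For distinct points $O,I$ let $\ell^{OI}$ be the line through them. For points $A,B\in\ell^{OI}$ the product $A\cdot B\in\ell^{OI}$ with respect to $(O,I)$ is constructed as follows: choose a point $B_1\notin\ell^{OI}$, let $P_1$ be the intersection of the line $OB_1$ with the line through $A$ parallel to $IB_1$, and let $A\cdot B$ be the intersection of $\ell^{OI}$ with the line through $P_1$ parallel to $BB_1$; for $B\neq O$, $B^{-1}\in\ell^{OI}$ is the point with $B^{-1}\cdot B=B\cdot B^{-1}=I$. For $A,B\in\ell^{OI}$ with $B\ne O$, the ratio of $A$ and $B$ with respect to $(O,I)$ is the point $r_{O,I}(A:B)=B^{-1}\cdot A$ of $\ell^{OI}$. A dilatation is a bijection $\delta$ of the set of points that maps lines to lines and satisfies $\delta(\ell^{PQ})\parallel \ell^{PQ}$ for all points $P\neq Q$. **Theorem.** Let $\delta$ be any dilatation of $\mathcal A$ (whether it fixes a point on $\ell^{OI}$,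 a point off $\ell^{OI}$, or no point at all), let $O\neq I$ be points, and let $A,B\in\ell^{OI}$ with $B\neq O$. Then $$\delta\bigl(r_{O,I}(A:B)\bigr)=r_{\delta(O),\delta(I)}\bigl(\delta(A):\delta(B)\bigr),$$ where the ratio on the right is formed on the line $\ell^{\delta(O)\delta(I)}=\delta(\ell^{OI})$ with zero $\delta(O)$ and unit $\delta(I)$. -/

import Mathlib

/-- An affine plane on the set of points `P`: lines are sets of points, two distinct points lie on
exactly one line, Playfair's parallel axiom holds, and there are three non-collinear points. -/
structure AffinePlane (P : Type*) where
  lines : Set (Set P)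
  existsUnique_line : ∀ p q : P, p ≠ q → ∃! l : Set P, l ∈ lines ∧ p ∈ l ∧ q ∈ l
  playfair : ∀ (p : P) (l : Set P), l ∈ lines → p ∉ l →
    ∃! m : Set P, m ∈ lines ∧ p ∈ m ∧ l ∩ m = ∅
  exists_noncollinear : ∃ p q r : P, p ≠ q ∧ q ≠ r ∧ p ≠ r ∧
    ∀ l ∈ lines, ¬ ({p, q, r} : Set P) ⊆ l

namespace AffinePlane

/-- Two lines are parallel when they are equal or have no common point. -/
def Parallel {P : Type*} (l m : Set P) : Prop := l = m ∨ l ∩ m = ∅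

/-- The line through two distinct points `p` and `q` (see `AffinePlane.line_mem_lines`). -/
def line {P : Type*} (𝒜 : AffinePlane P) (p q : P) : Set P :=
  ⋂₀ {l : Set P | l ∈ 𝒜.lines ∧ p ∈ l ∧ q ∈ l}

/-- The line through `p` parallel to the line `l` (see `AffinePlane.exists_parallelThrough_eq`). -/
def parallelThrough {P : Type*} (𝒜 : AffinePlane P) (p : P) (l : Set P) : Set P :=
  {x : P | ∃ m ∈ 𝒜.lines, p ∈ m ∧ Parallel l m ∧ x ∈ m}

end AffinePlane

/-- A Desargues affine plane: if `A, A'`, `B, B'`, `C, C'` lie on three distinct lines which are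
parallel, or which pass through a point `V` different from these six points, and if
`AB ∥ A'B'` and `BC ∥ B'C'`, then `AC ∥ A'C'`. -/
structure DesarguesAffinePlane (P : Type*) extends AffinePlane P where
  desargues : ∀ (a b c : Set P), a ∈ lines → b ∈ lines → c ∈ lines →
    a ≠ b → b ≠ c → a ≠ c →
    ∀ A A' B B' C C' : P, A ∈ a → A' ∈ a → B ∈ b → B' ∈ b → C ∈ c → C' ∈ c →
      ((AffinePlane.Parallel a b ∧ AffinePlane.Parallel b c) ∨
        ∃ V : P, V ∈ a ∧ V ∈ b ∧ V ∈ c ∧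
          A ≠ V ∧ A' ≠ V ∧ B ≠ V ∧ B' ≠ V ∧ C ≠ V ∧ C' ≠ V) →
      AffinePlane.Parallel (toAffinePlane.line A B) (toAffinePlane.line A' B') →
      AffinePlane.Parallel (toAffinePlane.line B C) (toAffinePlane.line B' C') →
      AffinePlane.Parallel (toAffinePlane.line A C) (toAffinePlane.line A' C')

namespace AffinePlane

theorem line_eq {P : Type*} (𝒜 : AffinePlane P) {p q : P} (h : p ≠ q) {l : Set P}
    (hl : l ∈ 𝒜.lines) (hp : p ∈ l) (hq : q ∈ l) : 𝒜.line p q = l := by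
  have : {m : Set P | m ∈ 𝒜.lines ∧ p ∈ m ∧ q ∈ m} = {l} := by
    ext m
    constructor
    · intro hm
      exact (𝒜.existsUnique_line p q h).unique hm ⟨hl, hp, hq⟩
    · rintro rfl
      exact ⟨hl, hp, hq⟩
  rw [line, this, Set.sInter_singleton]

theorem line_mem_lines {P : Type*} (𝒜 : AffinePlane P) {p q : P} (h : p ≠ q) :
    𝒜.line p q ∈ 𝒜.lines := by
  obtain ⟨l, hl, hp, hq⟩ := (𝒜.existsUnique_line p q h).exists
  rwa [𝒜.line_eq h hl hp hq]

theorem left_mem_line {P : Type*} (𝒜 : AffinePlane P) (p q : P) : p ∈ 𝒜.line p q :=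
  fun _ hl => hl.2.1

theorem right_mem_line {P : Type*} (𝒜 : AffinePlane P) (p q : P) : q ∈ 𝒜.line p q :=
  fun _ hl => hl.2.2

/-- Two lines with two distinct common points are equal. -/
theorem lines_eq {P : Type*} (𝒜 : AffinePlane P) {l m : Set P} (hl : l ∈ 𝒜.lines)
    (hm : m ∈ 𝒜.lines) {p q : P} (h : p ≠ q) (hpl : p ∈ l) (hql : q ∈ l) (hpm : p ∈ m)
    (hqm : q ∈ m) : l = m :=
  (𝒜.existsUnique_line p q h).unique ⟨hl, hpl, hql⟩ ⟨hm, hpm, hqm⟩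

/-- `parallelThrough p l` is the unique line through `p` that is parallel to the line `l`. -/
theorem exists_parallelThrough_eq {P : Type*} (𝒜 : AffinePlane P) (p : P) {l : Set P}
    (hl : l ∈ 𝒜.lines) : 𝒜.parallelThrough p l ∈ 𝒜.lines ∧ p ∈ 𝒜.parallelThrough p l ∧
      Parallel l (𝒜.parallelThrough p l) ∧
      ∀ m ∈ 𝒜.lines, p ∈ m → Parallel l m → m = 𝒜.parallelThrough p l := by
  obtain ⟨m, ⟨hm, hpm, hlm⟩, hu⟩ : ∃! m : Set P, m ∈ 𝒜.lines ∧ p ∈ m ∧ Parallel l m := by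
    by_cases hp : p ∈ l
    · refine ⟨l, ⟨hl, hp, Or.inl rfl⟩, ?_⟩
      rintro m ⟨_, hpm, h | h⟩
      · exact h.symm
      · exact absurd (h ▸ (⟨hp, hpm⟩ : p ∈ l ∩ m) : p ∈ (∅ : Set P)) (Set.notMem_empty p)
    · obtain ⟨m, ⟨hm, hpm, hlm⟩, hu⟩ := 𝒜.playfair p l hl hp
      refine ⟨m, ⟨hm, hpm, Or.inr hlm⟩, ?_⟩
      rintro m' ⟨hm', hpm', h | h⟩
      · exact absurd (h ▸ hpm') hp
      · exact hu m' ⟨hm', hpm', h⟩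
  have he : 𝒜.parallelThrough p l = m := by
    ext x
    constructor
    · rintro ⟨m', hm', hpm', hlm', hx⟩
      exact hu m' ⟨hm', hpm', hlm'⟩ ▸ hx
    · intro hx
      exact ⟨m, hm, hpm, hlm, hx⟩
  rw [he]
  exact ⟨hm, hpm, hlm, fun m' h1 h2 h3 => hu m' ⟨h1, h2, h3⟩⟩

theorem exists_notMem {P : Type*} (𝒜 : AffinePlane P) {l : Set P} (hl : l ∈ 𝒜.lines) :
    ∃ x : P, x ∉ l := by
  obtain ⟨p, q, r, -, -, -, h⟩ := 𝒜.exists_noncollinear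
  by_contra! hc
  exact h l hl fun x _ => hc x

/-- Let `l` and `m` be distinct lines through `v`. The line through `p` parallel to `l` meets
`m`. -/
theorem exists_mem_parallelThrough {P : Type*} (𝒜 : AffinePlane P) (p v : P) {l m : Set P}
    (hl : l ∈ 𝒜.lines) (hm : m ∈ 𝒜.lines) (hlm : l ≠ m) (hvl : v ∈ l) (hvm : v ∈ m) :
    ∃ x : P, x ∈ 𝒜.parallelThrough p l ∧ x ∈ m := by
  obtain ⟨hk, hpk, hpar, -⟩ := 𝒜.exists_parallelThrough_eq p hl
  set k := 𝒜.parallelThrough p l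
  by_cases hvk : v ∈ k
  · exact ⟨v, hvk, hvm⟩
  · by_contra! hc
    have h1 : k ∩ m = ∅ := Set.eq_empty_iff_forall_notMem.2 fun x hx => hc x hx.1 hx.2
    have h2 : k ∩ l = ∅ := by
      rcases hpar with h | h
      · exact absurd (h ▸ hvl) hvk
      · rwa [Set.inter_comm]
    exact hlm ((𝒜.playfair v k hk hvk).unique ⟨hl, hvl, h2⟩ ⟨hm, hvm, h1⟩)

/-- `C` is obtained from the points `A`, `B` of the line `OI` by the multiplication algorithm,
with `O` as zero and `I` as unit: choose `B₁` off the line `OI`; let `P₁` be the intersection of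
`OB₁` with the line through `A` parallel to `IB₁`; then `C` is the intersection of `OI` with the
line through `P₁` parallel to `BB₁`. -/
def IsProduct {P : Type*} (𝒜 : AffinePlane P) (O I A B C : P) : Prop :=
  ∃ B₁ P₁ : P, B₁ ∉ 𝒜.line O I ∧
    P₁ ∈ 𝒜.parallelThrough A (𝒜.line I B₁) ∩ 𝒜.line O B₁ ∧
    C ∈ 𝒜.parallelThrough P₁ (𝒜.line B B₁) ∩ 𝒜.line O I

/-- `X` is a multiplicative inverse of `B` on the line `OI`: `X · B = I` and `B · X = I`. -/
def IsInverse {P : Type*} (𝒜 : AffinePlane P) (O I B X : P) : Prop :=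
  X ∈ 𝒜.line O I ∧ 𝒜.IsProduct O I X B I ∧ 𝒜.IsProduct O I B X I

theorem exists_isProduct {P : Type*} (𝒜 : AffinePlane P) {O I A B : P} (hOI : O ≠ I)
    (hB : B ∈ 𝒜.line O I) : ∃ C : P, 𝒜.IsProduct O I A B C := by
  have hl := 𝒜.line_mem_lines hOI
  have hO := 𝒜.left_mem_line O I
  have hI := 𝒜.right_mem_line O I
  obtain ⟨B₁, hB₁⟩ := 𝒜.exists_notMem hl
  have ne : ∀ {x : P}, x ∈ 𝒜.line O I → x ≠ B₁ := fun hx h => hB₁ (h ▸ hx)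
  obtain ⟨P₁, hP₁⟩ := 𝒜.exists_mem_parallelThrough A B₁ (𝒜.line_mem_lines (ne hI))
    (𝒜.line_mem_lines (ne hO))
    (fun h => hB₁ (𝒜.lines_eq (𝒜.line_mem_lines (ne hO)) hl hOI (𝒜.left_mem_line _ _)
      (h ▸ 𝒜.left_mem_line _ _) hO hI ▸ 𝒜.right_mem_line _ _))
    (𝒜.right_mem_line _ _) (𝒜.right_mem_line _ _)
  obtain ⟨C, hC⟩ := 𝒜.exists_mem_parallelThrough P₁ B (𝒜.line_mem_lines (ne hB)) hl
    (fun h => hB₁ (h ▸ 𝒜.right_mem_line _ _)) (𝒜.left_mem_line _ _) hB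
  exact ⟨C, B₁, P₁, hB₁, hP₁, hC⟩

theorem exists_isInverse {P : Type*} (𝒜 : AffinePlane P) {O I B : P} (hOI : O ≠ I)
    (hB : B ∈ 𝒜.line O I) (hBO : B ≠ O) : ∃ X : P, 𝒜.IsInverse O I B X := by
  have hl := 𝒜.line_mem_lines hOI
  have hO := 𝒜.left_mem_line O I
  have hI := 𝒜.right_mem_line O I
  obtain ⟨B₁, hB₁⟩ := 𝒜.exists_notMem hl
  have ne : ∀ {x : P}, x ∈ 𝒜.line O I → x ≠ B₁ := fun hx h => hB₁ (h ▸ hx)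
  have hOB := 𝒜.line_mem_lines (ne hO)
  have hIB := 𝒜.line_mem_lines (ne hI)
  have hBB := 𝒜.line_mem_lines (ne hB)
  have off : ∀ {x : P}, x ∈ 𝒜.line O I → x ∈ 𝒜.line O B₁ → x = O := by
    intro x hx hx'
    by_contra hne
    exact hB₁ (𝒜.lines_eq hOB hl hne hx' (𝒜.left_mem_line _ _) hx hO ▸ 𝒜.right_mem_line _ _)
  -- `Q` is the intersection of `OB₁` with the line through `I` parallel to `BB₁`.
  obtain ⟨Q, hQ, hQO⟩ := 𝒜.exists_mem_parallelThrough I B₁ hBB hOB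
    (fun h => hBO (off hB (h ▸ 𝒜.left_mem_line _ _)))
    (𝒜.right_mem_line _ _) (𝒜.right_mem_line _ _)
  obtain ⟨hm, hIm, hparm, -⟩ := 𝒜.exists_parallelThrough_eq I hBB
  set m := 𝒜.parallelThrough I (𝒜.line B B₁) with hmdef
  -- `X` is the intersection of `OI` with the line through `Q` parallel to `IB₁`.
  obtain ⟨X, hX, hXl⟩ := 𝒜.exists_mem_parallelThrough Q I hIB hl
    (fun h => hB₁ (h ▸ 𝒜.right_mem_line _ _)) (𝒜.left_mem_line _ _) hI
  obtain ⟨hk, hQk, hpark, -⟩ := 𝒜.exists_parallelThrough_eq Q hIB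
  set k := 𝒜.parallelThrough Q (𝒜.line I B₁) with hkdef
  have hQl : Q ∉ 𝒜.line O I := by
    intro hQl
    have hQO' : Q = O := off hQl hQO
    subst hQO'
    have hml : m = 𝒜.line Q I := 𝒜.lines_eq hm hl hOI hQ hIm hO hI
    rcases hparm with h | h
    · exact hB₁ (hml ▸ h ▸ 𝒜.right_mem_line _ _)
    · exact absurd (h ▸ (⟨𝒜.left_mem_line _ _, hml ▸ hB⟩ : B ∈ 𝒜.line B B₁ ∩ m) :
        B ∈ (∅ : Set P)) (Set.notMem_empty _)
  have symm : ∀ {a b : Set P}, Parallel a b → Parallel b a := fun h =>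
    h.elim (fun h => Or.inl h.symm) fun h => Or.inr (by rwa [Set.inter_comm])
  have neQ : ∀ {x : P}, x ∈ 𝒜.line O I → x ≠ Q := fun hx h => hQl (h ▸ hx)
  have hOQ : 𝒜.line O Q = 𝒜.line O B₁ :=
    𝒜.line_eq (neQ hO) hOB (𝒜.left_mem_line _ _) hQO
  have hIQ : 𝒜.line I Q = m := 𝒜.line_eq (neQ hI) hm hIm hQ
  have hXQ : 𝒜.line X Q = k := 𝒜.line_eq (neQ hXl) hk hX hQk
  refine ⟨X, hXl, ⟨B₁, Q, hB₁, ⟨⟨k, hk, hX, hpark, hQk⟩, hQO⟩,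
    ⟨⟨m, hm, hQ, hparm, hIm⟩, hI⟩⟩, ⟨Q, B₁, hQl, ⟨⟨𝒜.line B B₁, hBB, 𝒜.left_mem_line _ _,
      hIQ ▸ symm hparm, 𝒜.right_mem_line _ _⟩, hOQ ▸ 𝒜.right_mem_line _ _⟩,
    ⟨⟨𝒜.line I B₁, hIB, 𝒜.right_mem_line _ _, hXQ ▸ symm hpark, 𝒜.left_mem_line _ _⟩, hI⟩⟩⟩

end AffinePlane

namespace DesarguesAffinePlane

/-- The product `A · B` of two points of the line `OI` with zero `O` and unit `I`. (Desargues'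
axiom makes it independent of the auxiliary point of the construction.) -/
noncomputable def mul {P : Type*} (𝒜 : DesarguesAffinePlane P) (O I A B : P) (hOI : O ≠ I)
    (hB : B ∈ 𝒜.line O I) : P :=
  (𝒜.exists_isProduct (A := A) hOI hB).choose

/-- The inverse `B⁻¹` of a point `B ≠ O` of the line `OI` with zero `O` and unit `I`. -/
noncomputable def inv {P : Type*} (𝒜 : DesarguesAffinePlane P) (O I B : P) (hOI : O ≠ I)
    (hB : B ∈ 𝒜.line O I) (hBO : B ≠ O) : P :=
  (𝒜.exists_isInverse hOI hB hBO).choose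

/-- The ratio `r(A : B) = B⁻¹ · A` of two points `A`, `B ≠ O` of the line `OI` with zero `O` and
unit `I`. -/
noncomputable def ratio {P : Type*} (𝒜 : DesarguesAffinePlane P) (O I A B : P) (hOI : O ≠ I)
    (hA : A ∈ 𝒜.line O I) (hB : B ∈ 𝒜.line O I) (hBO : B ≠ O) : P :=
  𝒜.mul O I (𝒜.inv O I B hOI hB hBO) A hOI hA

end DesarguesAffinePlane

/-- A dilatation of an affine plane: a collineation `δ` (a bijection of the points that maps lines
to lines) such that the image of every line `pq` is parallel to `pq`. -/
structure AffinePlane.Dilatation {P : Type*} (𝒜 : AffinePlane P) where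
  toPerm : Equiv.Perm P
  image_mem_lines : ∀ l ∈ 𝒜.lines, toPerm '' l ∈ 𝒜.lines
  image_parallel : ∀ p q : P, p ≠ q →
    AffinePlane.Parallel (toPerm '' 𝒜.line p q) (𝒜.line p q)

namespace AffinePlane.Dilatation

instance {P : Type*} {𝒜 : AffinePlane P} : CoeFun 𝒜.Dilatation fun _ => P → P :=
  ⟨fun δ => δ.toPerm⟩

theorem map_ne {P : Type*} {𝒜 : AffinePlane P} (δ : 𝒜.Dilatation) {p q : P} (h : p ≠ q) :
    δ p ≠ δ q :=
  δ.toPerm.injective.ne h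

theorem map_mem_line {P : Type*} {𝒜 : AffinePlane P} (δ : 𝒜.Dilatation) {p q x : P} (h : p ≠ q)
    (hx : x ∈ 𝒜.line p q) : δ x ∈ 𝒜.line (δ p) (δ q) := by
  rw [𝒜.line_eq (δ.map_ne h) (δ.image_mem_lines _ (𝒜.line_mem_lines h))
    (Set.mem_image_of_mem _ (𝒜.left_mem_line p q))
    (Set.mem_image_of_mem _ (𝒜.right_mem_line p q))]
  exact Set.mem_image_of_mem _ hx

end AffinePlane.Dilatation

/-!
The product on the line `OI` is given by a construction with an auxiliary point `B₁`, and product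
and inverse are chosen witnesses of this construction. The construction uses only incidence and
parallelism, and a dilatation, like every collineation, preserves both; so it carries products to
products (`AffinePlane.Dilatation.isProduct`) and inverses to inverses
(`AffinePlane.Dilatation.isInverse`). What remains is that products and inverses are unique, which
makes the choice of witnesses irrelevant.

Uniqueness is where Desargues' axiom enters. If `B₁` and `B₁'` lie on different lines through `O`,
the two auxiliary triangles `I B₁ B₁'` and `A P₁ P₁'` are in perspective from `O`, so
`B₁B₁' ∥ P₁P₁'`; then `B B₁ B₁'` and `C P₁ P₁'` are in perspective from `O`, so `BB₁' ∥ CP₁'`, and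
`B₁'` yields the same product `C` (`isProductWith_of_notMem`). If `B₁` and `B₁'` are collinear with
`O`, an auxiliary point on a third line through `O` mediates (`isProductWith_of_isProduct`). With
one auxiliary point for all products, `C` is determined by `A` and `B` (`IsProduct.unique`), and,
reading the construction backwards, `X` is determined by `B · X = I` (`IsInverse.unique`).
-/

namespace AffinePlane

variable {P : Type*} (𝒜 : AffinePlane P)

/-! ### Incidence and parallels -/

theorem line_comm (p q : P) : 𝒜.line p q = 𝒜.line q p := by
  simp only [line, and_comm (a := p ∈ _)]

theorem Parallel.symm {l m : Set P} (h : Parallel l m) : Parallel m l :=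
  h.elim (fun h => Or.inl h.symm) fun h => Or.inr (by rwa [Set.inter_comm])

theorem ne_of_notMem_line {p q r : P} (h : r ∉ 𝒜.line p q) : p ≠ r ∧ q ≠ r :=
  ⟨fun e => h (e ▸ 𝒜.left_mem_line _ _), fun e => h (e ▸ 𝒜.right_mem_line _ _)⟩

theorem notMem_line_swap {v p q : P} (hvp : v ≠ p) (h : q ∉ 𝒜.line v p) : p ∉ 𝒜.line v q :=
  fun hp => h <| 𝒜.line_eq hvp (𝒜.line_mem_lines (𝒜.ne_of_notMem_line h).1)
    (𝒜.left_mem_line _ _) hp ▸ 𝒜.right_mem_line _ _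

theorem line_eq_of_mem {v p q : P} (hvp : v ≠ p) (hvq : v ≠ q) (h : q ∈ 𝒜.line v p) :
    𝒜.line v q = 𝒜.line v p :=
  𝒜.line_eq hvq (𝒜.line_mem_lines hvp) (𝒜.left_mem_line _ _) h

theorem line_ne_of_notMem {v p q : P} (h : q ∉ 𝒜.line v p) : 𝒜.line v p ≠ 𝒜.line v q :=
  fun e => h (e ▸ 𝒜.right_mem_line _ _)

theorem mem_parallelThrough_comm {l : Set P} {p x : P} :
    x ∈ 𝒜.parallelThrough p l ↔ p ∈ 𝒜.parallelThrough x l :=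
  ⟨fun ⟨m, hm, hp, hpar, hx⟩ => ⟨m, hm, hx, hpar, hp⟩,
    fun ⟨m, hm, hp, hpar, hx⟩ => ⟨m, hm, hx, hpar, hp⟩⟩

theorem mem_parallelThrough_iff {l : Set P} {p x : P} (h : p ≠ x) :
    x ∈ 𝒜.parallelThrough p l ↔ Parallel l (𝒜.line p x) := by
  constructor
  · rintro ⟨m, hm, hp, hpar, hx⟩
    rwa [𝒜.line_eq h hm hp hx]
  · exact fun hpar =>
      ⟨_, 𝒜.line_mem_lines h, 𝒜.left_mem_line _ _, hpar, 𝒜.right_mem_line _ _⟩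

/-- A parallel to `l` meets a line `k` that crosses `l` in at most one point. -/
theorem parallelThrough_inter_unique {l k : Set P} {p v x y : P} (hl : l ∈ 𝒜.lines)
    (hk : k ∈ 𝒜.lines) (hlk : l ≠ k) (hvl : v ∈ l) (hvk : v ∈ k)
    (hx : x ∈ 𝒜.parallelThrough p l) (hy : y ∈ 𝒜.parallelThrough p l) (hxk : x ∈ k)
    (hyk : y ∈ k) : x = y := by
  by_contra hne
  obtain ⟨hm, -, hpar, -⟩ := 𝒜.exists_parallelThrough_eq p hl
  rw [𝒜.lines_eq hm hk hne hx hy hxk hyk] at hpar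
  rcases hpar with h | h
  · exact hlk h
  · exact Set.notMem_empty v (h ▸ ⟨hvl, hvk⟩)

/-- In a triangle `v p q`, a parallel to `pq` meets the line `vp` in at most one point. -/
theorem parallel_side_unique {v p q r x y : P} (hvp : v ≠ p) (hq : q ∉ 𝒜.line v p)
    (hx : x ∈ 𝒜.parallelThrough r (𝒜.line p q)) (hy : y ∈ 𝒜.parallelThrough r (𝒜.line p q))
    (hxk : x ∈ 𝒜.line v p) (hyk : y ∈ 𝒜.line v p) : x = y :=
  𝒜.parallelThrough_inter_unique (𝒜.line_mem_lines (𝒜.ne_of_notMem_line hq).2)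
    (𝒜.line_mem_lines hvp) (fun h => hq (h ▸ 𝒜.right_mem_line _ _)) (𝒜.left_mem_line _ _)
    (𝒜.right_mem_line _ _) hx hy hxk hyk

theorem self_mem_parallelThrough {l : Set P} (hl : l ∈ 𝒜.lines) (p : P) :
    p ∈ 𝒜.parallelThrough p l :=
  (𝒜.exists_parallelThrough_eq p hl).2.1

/-- Three lines through `O` exist: besides the lines `OI` and `OB`, take the parallel through `O`
to the line `IB`. -/
theorem exists_notMem_two_lines {O I B : P} (hOI : O ≠ I) (hB : B ∉ 𝒜.line O I) :
    ∃ x, x ∉ 𝒜.line O I ∧ x ∉ 𝒜.line O B := by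
  obtain ⟨hOB, hIB⟩ := 𝒜.ne_of_notMem_line hB
  have hI := 𝒜.notMem_line_swap hOI hB
  have hl := 𝒜.line_mem_lines hIB
  have hOm := 𝒜.self_mem_parallelThrough hl O
  have onOI : ∀ x ∈ 𝒜.parallelThrough O (𝒜.line I B), x ∈ 𝒜.line O I → x = O := fun x hx hxk =>
    𝒜.parallel_side_unique hOI hB hx hOm hxk (𝒜.left_mem_line _ _)
  have onOB : ∀ x ∈ 𝒜.parallelThrough O (𝒜.line I B), x ∈ 𝒜.line O B → x = O := fun x hx hxk =>
    𝒜.parallel_side_unique hOB hI (𝒜.line_comm I B ▸ hx) (𝒜.line_comm I B ▸ hOm) hxk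
      (𝒜.left_mem_line _ _)
  -- A second point on that parallel is its intersection with the parallel to `OB` through `I`.
  obtain ⟨x, hx, hxm⟩ := 𝒜.exists_mem_parallelThrough I O (𝒜.line_mem_lines hOB)
    (𝒜.exists_parallelThrough_eq O hl).1
    (fun e => hOB (onOB B (e ▸ 𝒜.right_mem_line _ _) (𝒜.right_mem_line _ _)).symm)
    (𝒜.left_mem_line _ _) hOm
  have hxO : x ≠ O := by
    rintro rfl
    obtain ⟨m, hm, hIm, hpar, hxm'⟩ := hx
    rcases hpar with rfl | h
    · exact hI hIm
    · exact Set.notMem_empty x (h ▸ ⟨𝒜.left_mem_line _ _, hxm'⟩)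
  exact ⟨x, fun h => hxO (onOI x hxm h), fun h => hxO (onOB x hxm h)⟩

/-! ### The multiplication algorithm with a given auxiliary point -/

/-- The multiplication algorithm on the line `OI`, run with the auxiliary point `B₁`, leads from
`A` and `B` to `C`. -/
def IsProductWith (O I A B B₁ C : P) : Prop :=
  ∃ P₁ : P, P₁ ∈ 𝒜.parallelThrough A (𝒜.line I B₁) ∩ 𝒜.line O B₁ ∧
    C ∈ 𝒜.parallelThrough P₁ (𝒜.line B B₁) ∩ 𝒜.line O I

theorem isProduct_iff {O I A B C : P} :
    𝒜.IsProduct O I A B C ↔ ∃ B₁, B₁ ∉ 𝒜.line O I ∧ 𝒜.IsProductWith O I A B B₁ C :=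
  ⟨fun ⟨B₁, P₁, h, hP, hC⟩ => ⟨B₁, h, P₁, hP, hC⟩, fun ⟨B₁, h, P₁, hP, hC⟩ => ⟨B₁, P₁, h, hP, hC⟩⟩

/-- In a triangle `v p q`, the parallel to `pq` through the vertex `v` meets the side `vp` only
in `v`. -/
theorem eq_vertex_of_parallel {v p q y : P} (hvp : v ≠ p) (hq : q ∉ 𝒜.line v p)
    (hy : y ∈ 𝒜.line v p) (h : v ∈ 𝒜.parallelThrough y (𝒜.line p q)) : y = v :=
  𝒜.parallel_side_unique hvp hq (𝒜.mem_parallelThrough_comm.1 h)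
    (𝒜.self_mem_parallelThrough (𝒜.line_mem_lines (𝒜.ne_of_notMem_line hq).2) v) hy
    (𝒜.left_mem_line _ _)

section

variable {O I A B B₁ C : P}

/-- The auxiliary point `P₁` exists for every choice of `B₁` off the line `OI`. -/
theorem exists_auxiliary (A : P) (hOI : O ≠ I) (hB₁ : B₁ ∉ 𝒜.line O I) :
    ∃ P₁, P₁ ∈ 𝒜.parallelThrough A (𝒜.line I B₁) ∩ 𝒜.line O B₁ := by
  obtain ⟨hO, hI⟩ := 𝒜.ne_of_notMem_line hB₁
  refine 𝒜.exists_mem_parallelThrough A B₁ (𝒜.line_mem_lines hI) (𝒜.line_mem_lines hO) ?_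
    (𝒜.right_mem_line _ _) (𝒜.right_mem_line _ _)
  exact fun e => 𝒜.notMem_line_swap hOI hB₁ (e ▸ 𝒜.left_mem_line _ _)

theorem notMem_line_of_mem (hOI : O ≠ I) (hB₁ : B₁ ∉ 𝒜.line O I) (hB : B ∈ 𝒜.line O I)
    (hBO : B ≠ O) : B₁ ∉ 𝒜.line O B := by
  rwa [𝒜.line_eq_of_mem hOI hBO.symm hB]

/-- With a common auxiliary point, `A · B` is determined by `A` and `B`. -/
theorem isProductWith_unique {C C' : P} (hOI : O ≠ I) (hB : B ∈ 𝒜.line O I)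
    (hB₁ : B₁ ∉ 𝒜.line O I)
    (h : 𝒜.IsProductWith O I A B B₁ C) (h' : 𝒜.IsProductWith O I A B B₁ C') : C = C' := by
  obtain ⟨P₁, hP, hC, hCl⟩ := h
  obtain ⟨P₁', hP', hC', hCl'⟩ := h'
  have hO := (𝒜.ne_of_notMem_line hB₁).1
  have hIl := 𝒜.notMem_line_swap hOI hB₁
  have : P₁ = P₁' := 𝒜.parallel_side_unique hO hIl (𝒜.line_comm I B₁ ▸ hP.1)
    (𝒜.line_comm I B₁ ▸ hP'.1) hP.2 hP'.2
  subst this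
  have hBB : B ≠ B₁ := fun e => hB₁ (e ▸ hB)
  exact 𝒜.parallelThrough_inter_unique (𝒜.line_mem_lines hBB) (𝒜.line_mem_lines hOI)
    (fun e => hB₁ (e ▸ 𝒜.right_mem_line _ _)) (𝒜.left_mem_line _ _) hB hC hC' hCl hCl'

/-- With a common auxiliary point, `X` is determined by `B` and `B · X`, provided that `B · X` is
not the zero `O`. -/
theorem isProductWith_right_unique {X X' : P} (hOI : O ≠ I) (hX : X ∈ 𝒜.line O I)
    (hX' : X' ∈ 𝒜.line O I) (hB₁ : B₁ ∉ 𝒜.line O I) (hCO : C ≠ O)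
    (h : 𝒜.IsProductWith O I B X B₁ C) (h' : 𝒜.IsProductWith O I B X' B₁ C) : X = X' := by
  obtain ⟨P₁, hP, hC, hCl⟩ := h
  obtain ⟨P₁', hP', hC', hCl'⟩ := h'
  have hO := (𝒜.ne_of_notMem_line hB₁).1
  have hIl := 𝒜.notMem_line_swap hOI hB₁
  have : P₁ = P₁' := 𝒜.parallel_side_unique hO hIl (𝒜.line_comm I B₁ ▸ hP.1)
    (𝒜.line_comm I B₁ ▸ hP'.1) hP.2 hP'.2
  subst this
  -- Both `XB₁` and `X'B₁` are the line through `B₁` parallel to `P₁C`.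
  have hPC : P₁ ≠ C := by
    rintro rfl
    rw [← 𝒜.line_eq_of_mem hO hCO.symm hP.2, 𝒜.line_eq_of_mem hOI hCO.symm hCl] at hIl
    exact hIl (𝒜.right_mem_line _ _)
  have hm := 𝒜.line_mem_lines hPC
  have aux : ∀ Y ∈ 𝒜.line O I, C ∈ 𝒜.parallelThrough P₁ (𝒜.line Y B₁) →
      Y ∈ 𝒜.parallelThrough B₁ (𝒜.line P₁ C) := by
    intro Y hY hCY
    have hYB : Y ≠ B₁ := fun e => hB₁ (e ▸ hY)
    exact ⟨_, 𝒜.line_mem_lines hYB, 𝒜.right_mem_line _ _,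
      ((𝒜.mem_parallelThrough_iff hPC).1 hCY).symm, 𝒜.left_mem_line _ _⟩
  refine 𝒜.parallelThrough_inter_unique hm (𝒜.line_mem_lines hOI) ?_ (𝒜.right_mem_line _ _) hCl
    (aux X hX hC) (aux X' hX' hC') hX hX'
  intro e
  have hPO : P₁ = O := by
    by_contra hne
    exact hIl <| 𝒜.line_eq_of_mem hO (Ne.symm hne) hP.2 ▸ 𝒜.line_eq_of_mem hOI (Ne.symm hne)
      (e ▸ 𝒜.left_mem_line _ _) ▸ 𝒜.right_mem_line _ _
  subst hPO
  -- The line `P₁C` is then `OI`, which is not parallel to `XB₁`.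
  have hXB : X ≠ B₁ := fun e => hB₁ (e ▸ hX)
  have hl := 𝒜.line_mem_lines hXB
  exact hCO (𝒜.parallelThrough_inter_unique hl (𝒜.line_mem_lines hOI)
    (fun e => hB₁ (e ▸ 𝒜.right_mem_line _ _)) (𝒜.left_mem_line _ _) hX hC
    (𝒜.self_mem_parallelThrough hl _) hCl (𝒜.left_mem_line _ _))

end

end AffinePlane

namespace DesarguesAffinePlane

variable {P : Type*} (𝒜 : DesarguesAffinePlane P)

/-! ### Independence of the auxiliary point -/

/-- The concurrent form of Desargues' axiom, with the parallelism of sides expressed by incidence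
with parallels: if `A B C` and `A' B' C'` are in perspective from `V`, and two pairs of
corresponding sides are parallel, so is the third pair. -/
theorem desargues_concurrent {V A A' B B' C C' : P} (hVA : V ≠ A) (hB : B ∉ 𝒜.line V A)
    (hC : C ∉ 𝒜.line V A) (hCB : C ∉ 𝒜.line V B) (hA' : A' ∈ 𝒜.line V A) (hB' : B' ∈ 𝒜.line V B)
    (hC' : C' ∈ 𝒜.line V C) (hA'V : A' ≠ V) (hB'V : B' ≠ V) (hC'V : C' ≠ V)
    (h₁ : B' ∈ 𝒜.parallelThrough A' (𝒜.line A B)) (h₂ : C' ∈ 𝒜.parallelThrough B' (𝒜.line B C)) :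
    C' ∈ 𝒜.parallelThrough A' (𝒜.line A C) := by
  have hVB := (𝒜.ne_of_notMem_line hB).1
  have hVC := (𝒜.ne_of_notMem_line hC).1
  have sep : ∀ {p q x y : P}, V ≠ p → q ∉ 𝒜.line V p → x ∈ 𝒜.line V p → y ∈ 𝒜.line V q →
      x ≠ V → x ≠ y := by
    rintro p q x _ hVp hq hx hy hxV rfl
    have hVq := (𝒜.ne_of_notMem_line hq).1
    exact hq <| 𝒜.line_eq_of_mem hVp hxV.symm hx ▸ 𝒜.line_eq_of_mem hVq hxV.symm hy ▸
      𝒜.right_mem_line _ _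
  rw [𝒜.mem_parallelThrough_iff (sep hVA hB hA' hB' hA'V)] at h₁
  rw [𝒜.mem_parallelThrough_iff (sep hVB hCB hB' hC' hB'V)] at h₂
  rw [𝒜.mem_parallelThrough_iff (sep hVA hC hA' hC' hA'V)]
  exact 𝒜.desargues _ _ _ (𝒜.line_mem_lines hVA) (𝒜.line_mem_lines hVB) (𝒜.line_mem_lines hVC)
    (𝒜.line_ne_of_notMem hB) (𝒜.line_ne_of_notMem hCB) (𝒜.line_ne_of_notMem hC) A A' B B' C C'
    (𝒜.right_mem_line _ _) hA' (𝒜.right_mem_line _ _) hB' (𝒜.right_mem_line _ _) hC'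
    (Or.inr ⟨V, 𝒜.left_mem_line _ _, 𝒜.left_mem_line _ _, 𝒜.left_mem_line _ _, hVA.symm, hA'V,
      hVB.symm, hB'V, hVC.symm, hC'V⟩) h₁ h₂

variable {𝒜} {O I A B B₁ B₁' C : P}

/-- Replacing the auxiliary point `B₁` by a point `B₁'` that is not collinear with `O` and `B₁`
does not change the product. -/
theorem isProductWith_of_notMem (hOI : O ≠ I) (hA : A ∈ 𝒜.line O I) (hB : B ∈ 𝒜.line O I)
    (hB₁ : B₁ ∉ 𝒜.line O I) (hB₁' : B₁' ∉ 𝒜.line O I) (hne : B₁' ∉ 𝒜.line O B₁)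
    (h : 𝒜.IsProductWith O I A B B₁ C) : 𝒜.IsProductWith O I A B B₁' C := by
  obtain ⟨P₁, ⟨hP, hPl⟩, hC, hCl⟩ := h
  obtain ⟨P₁', hP', hPl'⟩ := 𝒜.exists_auxiliary A hOI hB₁'
  refine ⟨P₁', ⟨hP', hPl'⟩, ?_, hCl⟩
  obtain ⟨hO, hI⟩ := 𝒜.ne_of_notMem_line hB₁
  obtain ⟨hO', hI'⟩ := 𝒜.ne_of_notMem_line hB₁'
  have hIl := 𝒜.notMem_line_swap hOI hB₁
  have hIl' := 𝒜.notMem_line_swap hOI hB₁'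
  rcases eq_or_ne B O with rfl | hBO
  · -- For `B = O` the last step runs along the lines `OB₁` and `OB₁'`, so `C = O`.
    have hCB : C = B := 𝒜.parallelThrough_inter_unique (𝒜.line_mem_lines hO)
      (𝒜.line_mem_lines hOI) (fun e => hB₁ (e ▸ 𝒜.right_mem_line _ _)) (𝒜.left_mem_line _ _)
      (𝒜.left_mem_line _ _) hC ⟨_, 𝒜.line_mem_lines hO, hPl, Or.inl rfl, 𝒜.left_mem_line _ _⟩ hCl
      (𝒜.left_mem_line _ _)
    rw [hCB]
    exact ⟨_, 𝒜.line_mem_lines hO', hPl', Or.inl rfl, 𝒜.left_mem_line _ _⟩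
  have hBB : B₁ ∉ 𝒜.line O B := 𝒜.notMem_line_of_mem hOI hB₁ hB hBO
  have hBB' : B₁' ∉ 𝒜.line O B := 𝒜.notMem_line_of_mem hOI hB₁' hB hBO
  have hBl := 𝒜.notMem_line_swap hBO.symm hBB
  have hCl' : C ∈ 𝒜.line O B := by rwa [𝒜.line_eq_of_mem hOI hBO.symm hB]
  rcases eq_or_ne A O with rfl | hAO
  · -- For `A = O` both auxiliary points `P₁` and `P₁'` are `O`, so again `C = O`.
    have hPA : P₁ = A := 𝒜.eq_vertex_of_parallel hO hIl hPl
      (𝒜.line_comm I B₁ ▸ 𝒜.mem_parallelThrough_comm.1 hP)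
    have hPA' : P₁' = A := 𝒜.eq_vertex_of_parallel hO' hIl' hPl'
      (𝒜.line_comm I B₁' ▸ 𝒜.mem_parallelThrough_comm.1 hP')
    subst hPA
    rw [hPA', 𝒜.eq_vertex_of_parallel hBO.symm hBB hCl' (𝒜.mem_parallelThrough_comm.1 hC)]
    exact 𝒜.self_mem_parallelThrough (𝒜.line_mem_lines (𝒜.ne_of_notMem_line hBB').2) _
  have hPO : P₁ ≠ O := by
    rintro rfl
    exact hAO (𝒜.eq_vertex_of_parallel hOI hB₁ hA hP)
  have hPO' : P₁' ≠ O := by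
    rintro rfl
    exact hAO (𝒜.eq_vertex_of_parallel hOI hB₁' hA hP')
  have hCO : C ≠ O := by
    rintro rfl
    exact hPO (𝒜.eq_vertex_of_parallel hO hBl hPl (𝒜.line_comm B B₁ ▸ hC))
  -- The triangles `B₁ I B₁'` and `P₁ A P₁'` are in perspective from `O`.
  have h₁ : P₁' ∈ 𝒜.parallelThrough P₁ (𝒜.line B₁ B₁') :=
    𝒜.desargues_concurrent hO hIl hne hB₁' hPl hA hPl' hPO hAO hPO'
      (𝒜.line_comm I B₁ ▸ 𝒜.mem_parallelThrough_comm.1 hP) hP'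
  -- The triangles `B B₁ B₁'` and `C P₁ P₁'` are in perspective from `O`.
  exact 𝒜.mem_parallelThrough_comm.1 <|
    𝒜.desargues_concurrent hBO.symm hBB hBB' hne hCl' hPl hPl' hCO hPO hPO'
      (𝒜.mem_parallelThrough_comm.1 hC) h₁

/-- A product can be computed with any auxiliary point. -/
theorem isProductWith_of_isProduct (hOI : O ≠ I) (hA : A ∈ 𝒜.line O I) (hB : B ∈ 𝒜.line O I)
    (hB₁ : B₁ ∉ 𝒜.line O I) (h : 𝒜.IsProduct O I A B C) : 𝒜.IsProductWith O I A B B₁ C := by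
  obtain ⟨B₁', hB₁', h⟩ := 𝒜.isProduct_iff.1 h
  by_cases hne : B₁ ∈ 𝒜.line O B₁'
  · obtain ⟨x, hx, hx'⟩ := 𝒜.exists_notMem_two_lines hOI hB₁
    have hO := (𝒜.ne_of_notMem_line hB₁).1
    have hO' := (𝒜.ne_of_notMem_line hB₁').1
    refine isProductWith_of_notMem hOI hA hB hx hB₁ (𝒜.notMem_line_swap hO hx') ?_
    exact isProductWith_of_notMem hOI hA hB hB₁' hx (𝒜.line_eq_of_mem hO' hO hne ▸ hx') h
  · exact isProductWith_of_notMem hOI hA hB hB₁' hB₁ hne h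

theorem _root_.AffinePlane.IsProduct.unique {C' : P} (hOI : O ≠ I) (hA : A ∈ 𝒜.line O I)
    (hB : B ∈ 𝒜.line O I) (h : 𝒜.IsProduct O I A B C) (h' : 𝒜.IsProduct O I A B C') : C = C' := by
  obtain ⟨B₁, hB₁⟩ := 𝒜.exists_notMem (𝒜.line_mem_lines hOI)
  exact 𝒜.isProductWith_unique hOI hB hB₁ (isProductWith_of_isProduct hOI hA hB hB₁ h)
    (isProductWith_of_isProduct hOI hA hB hB₁ h')

theorem _root_.AffinePlane.IsInverse.unique {X X' : P} (hOI : O ≠ I) (hB : B ∈ 𝒜.line O I)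
    (h : 𝒜.IsInverse O I B X) (h' : 𝒜.IsInverse O I B X') : X = X' := by
  obtain ⟨B₁, hB₁⟩ := 𝒜.exists_notMem (𝒜.line_mem_lines hOI)
  exact 𝒜.isProductWith_right_unique hOI h.1 h'.1 hB₁ hOI.symm
    (isProductWith_of_isProduct hOI hB h.1 hB₁ h.2.2)
    (isProductWith_of_isProduct hOI hB h'.1 hB₁ h'.2.2)

end DesarguesAffinePlane

/-! ### Dilatations -/

namespace AffinePlane.Dilatation

variable {P : Type*} {𝒜 : AffinePlane P} (δ : 𝒜.Dilatation) {O I A B C X : P}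

theorem image_line {p q : P} (h : p ≠ q) : δ.toPerm '' 𝒜.line p q = 𝒜.line (δ p) (δ q) :=
  (𝒜.line_eq (δ.map_ne h) (δ.image_mem_lines _ (𝒜.line_mem_lines h))
    (Set.mem_image_of_mem _ (𝒜.left_mem_line p q))
    (Set.mem_image_of_mem _ (𝒜.right_mem_line p q))).symm

theorem map_mem_parallelThrough {p q x y : P} (h : p ≠ q)
    (hx : x ∈ 𝒜.parallelThrough y (𝒜.line p q)) :
    δ x ∈ 𝒜.parallelThrough (δ y) (𝒜.line (δ p) (δ q)) := by
  obtain ⟨m, hm, hy, hpar, hx⟩ := hx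
  refine ⟨_, δ.image_mem_lines m hm, Set.mem_image_of_mem _ hy, ?_, Set.mem_image_of_mem _ hx⟩
  rw [← δ.image_line h]
  refine hpar.imp (congrArg _) fun h => ?_
  rw [← Set.image_inter δ.toPerm.injective, h, Set.image_empty]

theorem isProduct (hOI : O ≠ I) (hB : B ∈ 𝒜.line O I) (h : 𝒜.IsProduct O I A B C) :
    𝒜.IsProduct (δ O) (δ I) (δ A) (δ B) (δ C) := by
  obtain ⟨B₁, P₁, hB₁, ⟨hP, hPl⟩, hC, hCl⟩ := h
  obtain ⟨hO, hI⟩ := 𝒜.ne_of_notMem_line hB₁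
  refine ⟨δ B₁, δ P₁, ?_, ⟨δ.map_mem_parallelThrough hI hP, δ.map_mem_line hO hPl⟩,
    δ.map_mem_parallelThrough (fun e => hB₁ (e ▸ hB)) hC, δ.map_mem_line hOI hCl⟩
  rwa [← δ.image_line hOI, δ.toPerm.injective.mem_set_image]

theorem isInverse (hOI : O ≠ I) (hB : B ∈ 𝒜.line O I) (h : 𝒜.IsInverse O I B X) :
    𝒜.IsInverse (δ O) (δ I) (δ B) (δ X) :=
  ⟨δ.map_mem_line hOI h.1, δ.isProduct hOI hB h.2.1, δ.isProduct hOI h.1 h.2.2⟩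

end AffinePlane.Dilatation

theorem mainTheorem5 {P : Type*} (𝒜 : DesarguesAffinePlane P)
    (δ : 𝒜.toAffinePlane.Dilatation) (O I A B : P) (hOI : O ≠ I)
    (hA : A ∈ 𝒜.line O I) (hB : B ∈ 𝒜.line O I) (hBO : B ≠ O) :
    δ (𝒜.ratio O I A B hOI hA hB hBO) =
      𝒜.ratio (δ O) (δ I) (δ A) (δ B) (δ.map_ne hOI)
        (δ.map_mem_line hOI hA) (δ.map_mem_line hOI hB) (δ.map_ne hBO) := by
  have hinv := (𝒜.exists_isInverse hOI hB hBO).choose_spec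
  have hinv' := (𝒜.exists_isInverse (δ.map_ne hOI) (δ.map_mem_line hOI hB)
    (δ.map_ne hBO)).choose_spec
  have hr : 𝒜.IsProduct O I (𝒜.inv O I B hOI hB hBO) A (𝒜.ratio O I A B hOI hA hB hBO) :=
    (𝒜.exists_isProduct hOI hA).choose_spec
  have hr' : 𝒜.IsProduct (δ O) (δ I) (𝒜.inv (δ O) (δ I) (δ B) (δ.map_ne hOI)
      (δ.map_mem_line hOI hB) (δ.map_ne hBO)) (δ A) (𝒜.ratio (δ O) (δ I) (δ A) (δ B)
      (δ.map_ne hOI) (δ.map_mem_line hOI hA) (δ.map_mem_line hOI hB) (δ.map_ne hBO)) :=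
    (𝒜.exists_isProduct (δ.map_ne hOI) (δ.map_mem_line hOI hA)).choose_spec
  have he : δ (𝒜.inv O I B hOI hB hBO) = 𝒜.inv (δ O) (δ I) (δ B) (δ.map_ne hOI)
      (δ.map_mem_line hOI hB) (δ.map_ne hBO) :=
    AffinePlane.IsInverse.unique (δ.map_ne hOI) (δ.map_mem_line hOI hB)
      (δ.isInverse hOI hB hinv) hinv'
  rw [← he] at hr'
  exact AffinePlane.IsProduct.unique (δ.map_ne hOI) (δ.map_mem_line hOI hinv.1)
    (δ.map_mem_line hOI hA) (δ.isProduct hOI hA hr) hr'
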